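/- Let $(-\frac{d^2}{dx^2})^{1/2}$ denote the linear operator on $\mathbb R$ with Fourier symbol $|k|$, acting from $H^1(\mathbb R)$, modulo additive constants, to $L^2(\mathbb R)$. For $\nu>0$, $h\in\mathbb R$ and $\theta\in H^1_{\mathrm{loc}}(\mathbb R)$ let $$E(\theta)=\frac12\int_{\mathbb R}\Big\{(\theta')^2+(\sin\theta-h)^2+\frac{\nu}{2}(\sin\theta-h)\Big(-\frac{d^2}{dx^2}\Big)^{1/2}(\sin\theta-h)\Big\}\,dx ,$$ which is understood to be $+\infty$ unless $\theta'$ and $\sin\theta-h$ are in $L^2(\mathbb R)$. There exist constants $C_i=C_i(\nu,h,E(\theta))>0$, $i=1,2,\dots$, depending only on $i$, $\nu$, $h$ and $E(\theta)$, such that for all $\nu>0$ and $h\in\mathbb R$ every weak solution $\theta\in H^1_{\mathrm{loc}}(\mathbb R)$ (taken in its continuous representative) of the Euler–Lagrange equation $$-\theta''+(\sin\theta-h)\cos\theta+\frac{\nu}{2}\cos\theta\Big(-\frac{d^2}{dx^2}\Big)^{1/2}\sin\theta=0\quad\text{on }\mathbb R$$ with $E(\theta)<\infty$ is smooth and satisfies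 $$\sup_{x\in\mathbb R}\Big|\frac{d^i\theta}{dx^i}(x)\Big|\le C_i\qquad\text{for all } i\ge 1 .$$ Moreover, $\frac{d^i\theta}{dx^i}(x)\to0$ as $x\to\pm\infty$ for every $i\ge1$. -/

import Mathlib

open MeasureTheory Filter Topology FourierTransform
open scoped ContDiff ENNReal

namespace NeelWall

/-- `MemH1Loc θ`: the function `θ` is (the continuous representative of) an element of
`H¹_loc(ℝ)`, i.e. `θ` is absolutely continuous on every compact interval and its
almost everywhere defined derivative is square integrable on every compact interval. -/
def MemH1Loc (θ : ℝ → ℝ) : Prop :=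
  ∀ a b : ℝ, AbsolutelyContinuousOnInterval θ a b ∧
    MemLp (deriv θ) 2 (volume.restrict (Set.uIcc a b))

/-- `IsHalfLaplacian f v`: the real function `v ∈ L²(ℝ)` is the image of `f` under the operator
`(-d²/dx²)^{1/2}` with Fourier symbol `|k|`, where `f` is taken modulo additive constants: for
some real constant `c` the function `f - c` is in `L²(ℝ)` and the `L²` Fourier transforms satisfy
`v̂ = |k| (f - c)^`.  Mathlib's Fourier transform uses the phase `exp (-2πi x ξ)`, so that the
wave number is `k = 2πξ`. -/
def IsHalfLaplacian (f v : ℝ → ℝ) : Prop :=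
  ∃ (c : ℝ) (hf : MemLp (fun x => ((f x - c : ℝ) : ℂ)) 2 (volume : Measure ℝ))
    (hv : MemLp (fun x => (v x : ℂ)) 2 (volume : Measure ℝ)),
    ∀ᵐ ξ : ℝ, (𝓕 (hv.toLp _) : Lp ℂ 2 (volume : Measure ℝ)) ξ =
      ((2 * Real.pi * |ξ| : ℝ) : ℂ) * (𝓕 (hf.toLp _) : Lp ℂ 2 (volume : Measure ℝ)) ξ

/-- The image under `(-d²/dx²)^{1/2}` is unique up to null sets. -/
theorem IsHalfLaplacian.ae_unique {f v w : ℝ → ℝ} (hv : IsHalfLaplacian f v)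
    (hw : IsHalfLaplacian f w) : v =ᵐ[volume] w := by
  obtain ⟨c, hfc, hv, hve⟩ := hv
  obtain ⟨d, hfd, hw, hwe⟩ := hw
  have hcd : c = d := by
    have h := hfd.sub hfc
    have h2 : MemLp (fun _ : ℝ => ((c - d : ℝ) : ℂ)) 2 (volume : Measure ℝ) := by
      refine h.ae_eq (Eventually.of_forall fun x => ?_)
      simp
    rw [memLp_const_iff (by norm_num) (by norm_num)] at h2
    rcases h2 with h2 | h2
    · exact sub_eq_zero.1 (by exact_mod_cast h2)
    · simp at h2
  subst hcd
  have h1 : 𝓕 (hv.toLp _) = 𝓕 (hw.toLp _) := by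
    apply Lp.ext
    filter_upwards [hve, hwe] with ξ h1 h2
    rw [h1, h2]
  have h2 : hv.toLp _ = hw.toLp _ :=
    (Lp.fourierTransformₗᵢ ℝ ℂ).injective h1
  rw [MemLp.toLp_eq_toLp_iff] at h2
  filter_upwards [h2] with x hx
  exact_mod_cast hx

open Classical in
/-- The operator `(-d²/dx²)^{1/2}` with Fourier symbol `|k|`, from `H¹(ℝ)` modulo additive
constants to `L²(ℝ)`; a representative of the (almost everywhere unique) image of `f`, and the
junk value `0` outside the domain. -/
noncomputable def halfLaplacian (f : ℝ → ℝ) : ℝ → ℝ :=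
  if h : ∃ v, IsHalfLaplacian f v then h.choose else 0

open Classical in
/-- The energy
`E(θ) = ½ ∫ { (θ')² + (sin θ - h)² + (ν/2) (sin θ - h) (-d²/dx²)^{1/2} (sin θ - h) } dx`
of `θ ∈ H¹_loc(ℝ)`.  All three contributions are nonnegative, and `E(θ) = +∞` unless
`θ'` and `sin θ - h` are square integrable; if they are, then `sin θ - h ∈ H¹(ℝ)`, hence
`(-d²/dx²)^{1/2} (sin θ - h) ∈ L²(ℝ)`, and the integrand is integrable. -/
noncomputable def energy (ν h : ℝ) (θ : ℝ → ℝ) : ℝ≥0∞ :=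
  if MemLp (deriv θ) 2 volume ∧ MemLp (fun x => Real.sin (θ x) - h) 2 volume then
    ENNReal.ofReal ((1 / 2) * ∫ x, ((deriv θ x) ^ 2 + (Real.sin (θ x) - h) ^ 2 +
      (ν / 2) * ((Real.sin (θ x) - h) * halfLaplacian (fun y => Real.sin (θ y) - h) x)))
  else ⊤

/-- `θ` is a weak solution of the Euler–Lagrange equation
`-θ'' + (sin θ - h) cos θ + (ν/2) cos θ (-d²/dx²)^{1/2} sin θ = 0` on `ℝ`, tested against
smooth compactly supported functions. -/
def IsWeakSolution (ν h : ℝ) (θ : ℝ → ℝ) : Prop :=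
  ∀ φ : ℝ → ℝ, ContDiff ℝ ∞ φ → HasCompactSupport φ →
    ∫ x, (deriv θ x * deriv φ x +
      ((Real.sin (θ x) - h) * Real.cos (θ x) +
        (ν / 2) * Real.cos (θ x) * halfLaplacian (fun y => Real.sin (θ y)) x) * φ x) = 0

end NeelWall

/-! Write `|D|` for the operator with symbol `|k|`. The equation says that `θ'' = cos θ · ((sin θ -
h) + (ν/2) |D|(sin θ - h))` weakly, and regularity follows by bootstrapping it in the Sobolev scale.
If `θ'` is in `H^m` and `cos θ` in `W^{m,∞}`, then `sin θ - h`, whose derivative is `cos θ · θ'`, is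
in `H^{m+1}`. By Plancherel `|D|` costs exactly one derivative, so the right-hand side is in `H^m`
and `θ'` is in `H^{m+1}` (`IsWeakSolution.exists_sob_succ`). Sobolev embedding of `θ'` returns the
bound for `cos θ` needed at the next order (`exists_trig_bound`).

The induction starts from the energy: the nonlocal term is `∫ |k| |f̂|² ≥ 0` up to a positive
factor, so `‖θ'‖²` and `‖sin θ - h‖²` in `L²` are at most `2E` (`l2Le_of_energy`). Every later bound
depends only on `ν`, the order and this one. Finally, functions in `H^{m+1}(ℝ)` are `C^m` with
derivatives up to order `m` bounded and vanishing at infinity (`Sob.contDiff`). -/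

namespace NeelWall

open scoped NNReal

/-! ### Calculus of locally absolutely continuous functions -/

/-- `u` is locally absolutely continuous with almost everywhere derivative `w`. -/
structure IsPrim (u w : ℝ → ℝ) : Prop where
  ac : ∀ a b : ℝ, AbsolutelyContinuousOnInterval u a b
  deriv_ae : deriv u =ᵐ[volume] w

theorem IsPrim.congr {u w w' : ℝ → ℝ} (h : IsPrim u w) (hw : w =ᵐ[volume] w') : IsPrim u w' :=
  ⟨h.ac, h.deriv_ae.trans hw⟩

theorem ae_differentiableAt_of_ac {u : ℝ → ℝ}
    (h : ∀ a b : ℝ, AbsolutelyContinuousOnInterval u a b) :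
    ∀ᵐ x : ℝ, DifferentiableAt ℝ u x := by
  have : ∀ n : ℕ, ∀ᵐ x : ℝ, x ∈ Set.uIcc (-(n : ℝ)) n → DifferentiableAt ℝ u x :=
    fun n => (h _ _).ae_differentiableAt
  filter_upwards [ae_all_iff.2 this] with x hx
  obtain ⟨n, hn⟩ := exists_nat_ge |x|
  refine hx n ?_
  rw [Set.uIcc_of_le (by linarith [abs_nonneg x])]
  exact abs_le.1 hn

theorem IsPrim.ae_hasDerivAt {u w : ℝ → ℝ} (h : IsPrim u w) :
    ∀ᵐ x : ℝ, HasDerivAt u (w x) x := by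
  filter_upwards [ae_differentiableAt_of_ac h.ac, h.deriv_ae] with x h1 h2
  rw [← h2]
  exact h1.hasDerivAt

theorem isPrim_of_ae_hasDerivAt {u w : ℝ → ℝ}
    (h : ∀ a b : ℝ, AbsolutelyContinuousOnInterval u a b)
    (hd : ∀ᵐ x : ℝ, HasDerivAt u (w x) x) : IsPrim u w :=
  ⟨h, hd.mono fun _ hx => hx.deriv⟩

theorem IsPrim.continuous {u w : ℝ → ℝ} (h : IsPrim u w) : Continuous u := by
  refine continuous_iff_continuousAt.2 fun x => ?_
  refine (h.ac (x - 1) (x + 1)).continuousOn.continuousAt ?_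
  rw [Set.uIcc_of_le (by linarith)]
  exact Icc_mem_nhds (by linarith) (by linarith)

theorem IsPrim.integral_eq {u w : ℝ → ℝ} (h : IsPrim u w) (a b : ℝ) :
    ∫ x in a..b, w x = u b - u a := by
  rw [← (h.ac a b).integral_deriv_eq_sub]
  exact (intervalIntegral.integral_congr_ae (h.deriv_ae.mono fun x hx _ => hx)).symm

theorem IsPrim.eq_integral {u w : ℝ → ℝ} (h : IsPrim u w) (a x : ℝ) :
    u x = u a + ∫ t in a..x, w t := by
  rw [h.integral_eq]; ring

theorem isPrim_integral {w : ℝ → ℝ} (hw : LocallyIntegrable w) (c : ℝ) :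
    IsPrim (fun x => c + ∫ t in (0 : ℝ)..x, w t) w := by
  have hi : ∀ a b : ℝ, IntervalIntegrable w volume a b := fun a b =>
    (hw.integrableOn_isCompact isCompact_uIcc).intervalIntegrable
  have hc : ∀ a b : ℝ, AbsolutelyContinuousOnInterval (fun _ : ℝ => c) a b := fun a b =>
    (contDiff_const.contDiffOn (n := 1)).absolutelyContinuousOnInterval
  refine isPrim_of_ae_hasDerivAt (fun a b => ?_) ?_
  -- The interval is enlarged to contain the base point `0` as well as `a` and `b`.
  · have h1 := (hi (-(|a| + |b|)) (|a| + |b|)).absolutelyContinuousOnInterval_intervalIntegral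
      (c := 0) (by
        rw [Set.uIcc_of_le (by linarith [abs_nonneg a, abs_nonneg b])]
        constructor <;> linarith [abs_nonneg a, abs_nonneg b])
    refine (hc a b).fun_add (h1.mono ?_)
    refine Set.uIcc_subset_uIcc ?_ ?_ <;>
    · rw [Set.uIcc_of_le (by linarith [abs_nonneg a, abs_nonneg b])]
      constructor <;> linarith [abs_nonneg a, abs_nonneg b, neg_abs_le a, neg_abs_le b,
        le_abs_self a, le_abs_self b]
  · have h1 : ∀ n : ℕ, _ := fun n : ℕ => (hi (-(n : ℝ)) n).ae_hasDerivAt_integral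
    filter_upwards [ae_all_iff.2 h1] with x hx
    obtain ⟨n, hn⟩ := exists_nat_ge |x|
    have hn0 : (0 : ℝ) ≤ n := (abs_nonneg x).trans hn
    refine (hx n ?_ 0 ?_).const_add c
    · rw [Set.uIcc_of_le (by linarith)]
      exact abs_le.1 hn
    · rw [Set.uIcc_of_le (by linarith)]
      constructor <;> linarith

theorem IsPrim.hasDerivAt {u w : ℝ → ℝ} (h : IsPrim u w) (hw : Continuous w) (x : ℝ) :
    HasDerivAt u (w x) x := by
  have h1 := (intervalIntegral.integral_hasDerivAt_right (hw.intervalIntegrable 0 x)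
    (hw.stronglyMeasurableAtFilter _ _) hw.continuousAt).const_add (u 0)
  have h2 : u = fun x => u 0 + ∫ t in (0 : ℝ)..x, w t := funext fun x => h.eq_integral 0 x
  rw [h2]
  simpa using h1

theorem isPrim_of_hasDerivAt {u w : ℝ → ℝ} (h : ∀ x, HasDerivAt u (w x) x) (hw : Continuous w) :
    IsPrim u w := by
  have hd : deriv u = w := funext fun x => (h x).deriv
  have hc : ContDiff ℝ 1 u := by
    rw [contDiff_one_iff_deriv, hd]
    exact ⟨fun x => (h x).differentiableAt, hw⟩
  exact ⟨fun a b => hc.contDiffOn.absolutelyContinuousOnInterval, by rw [hd]⟩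

theorem IsPrim.add {u₁ w₁ u₂ w₂ : ℝ → ℝ} (h₁ : IsPrim u₁ w₁) (h₂ : IsPrim u₂ w₂) :
    IsPrim (fun x => u₁ x + u₂ x) (fun x => w₁ x + w₂ x) :=
  isPrim_of_ae_hasDerivAt (fun a b => (h₁.ac a b).fun_add (h₂.ac a b)) (by
    filter_upwards [h₁.ae_hasDerivAt, h₂.ae_hasDerivAt] with x h1 h2 using h1.add h2)

theorem IsPrim.mul {u₁ w₁ u₂ w₂ : ℝ → ℝ} (h₁ : IsPrim u₁ w₁) (h₂ : IsPrim u₂ w₂) :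
    IsPrim (fun x => u₁ x * u₂ x) (fun x => w₁ x * u₂ x + u₁ x * w₂ x) :=
  isPrim_of_ae_hasDerivAt (fun a b => (h₁.ac a b).fun_mul (h₂.ac a b)) (by
    filter_upwards [h₁.ae_hasDerivAt, h₂.ae_hasDerivAt] with x h1 h2 using h1.mul h2)

theorem isPrim_const (c : ℝ) : IsPrim (fun _ => c) (fun _ => 0) :=
  isPrim_of_hasDerivAt (fun x => hasDerivAt_const x c) continuous_const

theorem _root_.AbsolutelyContinuousOnInterval.lipschitz_comp {u F : ℝ → ℝ} {a b : ℝ}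
    (hu : AbsolutelyContinuousOnInterval u a b) (hF : LipschitzWith 1 F) :
    AbsolutelyContinuousOnInterval (fun x => F (u x)) a b := by
  refine squeeze_zero (fun E => Finset.sum_nonneg fun _ _ => dist_nonneg) (fun E => ?_) hu
  refine Finset.sum_le_sum fun i _ => ?_
  simpa using hF.dist_le_mul (u (E.2 i).1) (u (E.2 i).2)

theorem IsPrim.comp {u w F F' : ℝ → ℝ} (h : IsPrim u w) (hF : ∀ x, HasDerivAt F (F' x) x)
    (hL : LipschitzWith 1 F) : IsPrim (fun x => F (u x)) (fun x => F' (u x) * w x) :=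
  isPrim_of_ae_hasDerivAt (fun a b => (h.ac a b).lipschitz_comp hL) (by
    filter_upwards [h.ae_hasDerivAt] with x hx using (hF (u x)).comp x hx)

theorem IsPrim.sin {u w : ℝ → ℝ} (h : IsPrim u w) :
    IsPrim (fun x => Real.sin (u x)) (fun x => Real.cos (u x) * w x) :=
  h.comp Real.hasDerivAt_sin Real.lipschitzWith_sin

theorem IsPrim.cos {u w : ℝ → ℝ} (h : IsPrim u w) :
    IsPrim (fun x => Real.cos (u x)) (fun x => -Real.sin (u x) * w x) :=
  h.comp Real.hasDerivAt_cos Real.lipschitzWith_cos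

/-- Integrability of `w` makes the limit exist; a nonzero limit would contradict integrability of
`u` on a half-line of infinite measure. -/
theorem IsPrim.tendsto_atTop {u w : ℝ → ℝ} (h : IsPrim u w) (hu : Integrable u)
    (hw : Integrable w) : Tendsto u atTop (𝓝 0) := by
  have h1 : Tendsto u atTop (𝓝 (u 0 + ∫ t in Set.Ioi (0 : ℝ), w t)) := by
    refine ((intervalIntegral_tendsto_integral_Ioi 0 hw.integrableOn tendsto_id).const_add
      (u 0)).congr fun x => ?_
    exact (h.eq_integral 0 x).symm
  have h2 : u 0 + ∫ t in Set.Ioi (0 : ℝ), w t = 0 := by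
    refine IntegrableAtFilter.eq_zero_of_tendsto (hu.integrableAtFilter atTop) (fun s hs => ?_) h1
    obtain ⟨b, hb⟩ := mem_atTop_sets.1 hs
    exact top_unique (le_trans (by simp) (measure_mono (show Set.Ici b ⊆ s from hb)))
  rwa [h2] at h1

theorem IsPrim.tendsto_atBot {u w : ℝ → ℝ} (h : IsPrim u w) (hu : Integrable u)
    (hw : Integrable w) : Tendsto u atBot (𝓝 0) := by
  have h1 : Tendsto u atBot (𝓝 (u 0 - ∫ t in Set.Iic (0 : ℝ), w t)) := by
    refine ((intervalIntegral_tendsto_integral_Iic 0 hw.integrableOn tendsto_id).const_sub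
      (u 0)).congr fun x => ?_
    rw [id, h.integral_eq x 0]; ring
  have h2 : u 0 - ∫ t in Set.Iic (0 : ℝ), w t = 0 := by
    refine IntegrableAtFilter.eq_zero_of_tendsto (hu.integrableAtFilter atBot) (fun s hs => ?_) h1
    obtain ⟨b, hb⟩ := mem_atBot_sets.1 hs
    exact top_unique (le_trans (by simp) (measure_mono (show Set.Iic b ⊆ s from hb)))
  rwa [h2] at h1

theorem IsPrim.integral_Iic {u w : ℝ → ℝ} (h : IsPrim u w) (hu : Integrable u)
    (hw : Integrable w) (x : ℝ) : ∫ t in Set.Iic x, w t = u x := by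
  have h1 := (h.tendsto_atBot hu hw).const_sub (u x)
  rw [sub_zero] at h1
  refine tendsto_nhds_unique
    (intervalIntegral_tendsto_integral_Iic x hw.integrableOn tendsto_id) (h1.congr fun y => ?_)
  exact (h.integral_eq y x).symm

theorem IsPrim.integral_eq_zero {u w : ℝ → ℝ} (h : IsPrim u w) (hu : Integrable u)
    (hw : Integrable w) : ∫ x, w x = 0 := by
  have h1 := intervalIntegral_tendsto_integral hw tendsto_neg_atTop_atBot tendsto_id
  have h2 := (h.tendsto_atTop hu hw).sub
    ((h.tendsto_atBot hu hw).comp tendsto_neg_atTop_atBot)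
  rw [sub_zero] at h2
  refine tendsto_nhds_unique h1 (h2.congr fun y => ?_)
  exact (h.integral_eq (-y) y).symm

/-! ### Weak derivatives -/

/-- Du Bois-Reymond: a locally integrable function with vanishing weak derivative is constant. -/
theorem ae_const_of_weak_deriv_zero {u : ℝ → ℝ} (hu : LocallyIntegrable u)
    (h : ∀ φ : ℝ → ℝ, ContDiff ℝ ∞ φ → HasCompactSupport φ → ∫ x, u x * deriv φ x = 0) :
    ∃ c : ℝ, u =ᵐ[volume] fun _ => c := by
  obtain ⟨b⟩ : Nonempty (ContDiffBump (0 : ℝ)) := ⟨⟨1, 2, by norm_num, by norm_num⟩⟩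
  set ψ : ℝ → ℝ := b.normed volume with hψ
  have hψd : ContDiff ℝ ∞ ψ := b.contDiff_normed
  have hψc : HasCompactSupport ψ := b.hasCompactSupport_normed
  have hψ1 : ∫ x, ψ x = 1 := b.integral_normed
  have hmul : ∀ φ : ℝ → ℝ, Continuous φ → HasCompactSupport φ →
      Integrable (fun x => φ x * u x) := fun φ h1 h2 =>
    hu.integrable_smul_left_of_hasCompactSupport h1 h2
  refine ⟨∫ x, ψ x * u x, ?_⟩
  set c := ∫ x, ψ x * u x with hc
  have key := ae_eq_of_integral_contDiff_smul_eq (μ := volume) hu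
    (locallyIntegrable_const (μ := volume) c) (fun φ hφ hφc => ?_)
  · exact key
  set I := ∫ x, φ x with hI
  -- Subtracting `I * ψ` gives `g` mean zero, so that its primitive `G` has compact support and is
  -- an admissible test function.
  set g : ℝ → ℝ := fun x => φ x - I * ψ x with hg
  have hgd : ContDiff ℝ ∞ g := hφ.sub (contDiff_const.mul hψd)
  have hgc : HasCompactSupport g := hφc.sub hψc.mul_left
  have hφi : Integrable φ := hφ.continuous.integrable_of_hasCompactSupport hφc
  have hψi : Integrable ψ := hψd.continuous.integrable_of_hasCompactSupport hψc
  have hgi : Integrable g := hφi.sub (hψi.const_mul I)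
  have hg0 : ∫ x, g x = 0 := by
    rw [hg, integral_sub hφi (hψi.const_mul I), integral_const_mul, hψ1]; simp [hI]
  set G : ℝ → ℝ := fun x => ∫ t in Set.Iic x, g t with hG
  obtain ⟨R, hR⟩ : ∃ R : ℝ, tsupport g ⊆ Set.Icc (-R) R := by
    obtain ⟨R, hR⟩ := hgc.isCompact.isBounded.subset_closedBall 0
    exact ⟨R, by simpa [Real.closedBall_eq_Icc] using hR⟩
  have hG' : ∀ x, HasDerivAt G (g x) x := fun x => by
    have h1 : G = fun y => (∫ t in Set.Iic (0 : ℝ), g t) + ∫ t in (0 : ℝ)..y, g t := by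
      funext y
      rw [← intervalIntegral.integral_Iic_sub_Iic hgi.integrableOn hgi.integrableOn]; ring
    rw [h1]
    exact (intervalIntegral.integral_hasDerivAt_right (hgd.continuous.intervalIntegrable 0 x)
      (hgd.continuous.stronglyMeasurableAtFilter _ _) hgd.continuous.continuousAt).const_add _
  have hGd : ContDiff ℝ ∞ G := by
    rw [contDiff_infty_iff_deriv]
    refine ⟨fun x => (hG' x).differentiableAt, ?_⟩
    rwa [show deriv G = g from funext fun x => (hG' x).deriv]
  have hz : ∀ t, t ∉ Set.Icc (-R) R → g t = 0 := fun t ht =>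
    image_eq_zero_of_notMem_tsupport fun h => ht (hR h)
  have hGc : HasCompactSupport G := by
    refine HasCompactSupport.of_support_subset_isCompact (isCompact_Icc (a := -R) (b := R))
      fun x hx => ?_
    by_contra hxR
    apply hx
    rw [Set.mem_Icc, not_and_or, not_le, not_le] at hxR
    rcases hxR with hxR | hxR
    · refine setIntegral_eq_zero_of_forall_eq_zero fun t ht => hz t fun h => ?_
      have := h.1; have := Set.mem_Iic.1 ht; linarith
    · rw [hG, ← hg0]
      refine setIntegral_eq_integral_of_forall_compl_eq_zero fun t ht => hz t fun h => ?_
      have := h.2; have := not_le.1 (fun h => ht (Set.mem_Iic.2 h)); linarith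
  have h0 := h G hGd hGc
  rw [show deriv G = g from funext fun x => (hG' x).deriv] at h0
  have h1 : ∀ x, u x * g x = φ x * u x - I * (ψ x * u x) := fun x => by simp only [hg]; ring
  simp_rw [h1] at h0
  rw [integral_sub (hmul φ hφ.continuous hφc) ((hmul ψ hψd.continuous hψc).const_mul I),
    integral_const_mul] at h0
  simp only [smul_eq_mul]
  rw [integral_mul_const]
  linarith

/-- A locally integrable function with locally integrable weak derivative has a locally absolutely
continuous representative. -/
theorem exists_isPrim_of_weak {u w : ℝ → ℝ} (hu : LocallyIntegrable u) (hw : LocallyIntegrable w)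
    (h : ∀ φ : ℝ → ℝ, ContDiff ℝ ∞ φ → HasCompactSupport φ →
      ∫ x, (u x * deriv φ x + w x * φ x) = 0) :
    ∃ u', u' =ᵐ[volume] u ∧ IsPrim u' w := by
  have hW := isPrim_integral hw 0
  set W : ℝ → ℝ := fun x => 0 + ∫ t in (0 : ℝ)..x, w t with hWdef
  have hWl : LocallyIntegrable W := hW.continuous.locallyIntegrable
  -- Both `u` and the primitive `W` have weak derivative `w`, so their difference is constant.
  obtain ⟨c, hc⟩ := ae_const_of_weak_deriv_zero (hu.sub hWl) (fun φ hφ hφc => by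
    have hφ' : Continuous (deriv φ) := hφ.continuous_deriv (by simp)
    have hφc' : HasCompactSupport (deriv φ) := hφc.deriv
    have hmul : ∀ {v φ : ℝ → ℝ}, LocallyIntegrable v → Continuous φ → HasCompactSupport φ →
      Integrable (fun x => v x * φ x) := fun h0 h1 h2 => by
        simpa [mul_comm] using h0.integrable_smul_left_of_hasCompactSupport h1 h2
    have h1 := h φ hφ hφc
    have hp : IsPrim φ (deriv φ) := isPrim_of_hasDerivAt
      (fun x => (hφ.differentiable (by simp) x).hasDerivAt) hφ'
    have h2 := (hW.mul hp).integral_eq_zero (hmul hWl hφ.continuous hφc)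
      ((hmul hw hφ.continuous hφc).add (hmul hWl hφ' hφc'))
    rw [integral_add (hmul hu hφ' hφc') (hmul hw hφ.continuous hφc)] at h1
    rw [integral_add (hmul hw hφ.continuous hφc) (hmul hWl hφ' hφc')] at h2
    simp only [Pi.sub_apply, sub_mul]
    rw [integral_sub (hmul hu hφ' hφc') (hmul hWl hφ' hφc')]
    linarith)
  refine ⟨fun x => c + W x, ?_, by simpa using (isPrim_const c).add hW⟩
  filter_upwards [hc] with x hx
  rw [← hx]; simp

/-! ### Quantitative `H^m` and `W^{m,∞}` classes -/

/-- The function `f` is in `L²(ℝ)` with norm at most `B`. -/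
def L2Le (f : ℝ → ℝ) (B : ℝ≥0) : Prop :=
  AEStronglyMeasurable f volume ∧ eLpNorm f 2 volume ≤ B

theorem L2Le.memLp {f : ℝ → ℝ} {B : ℝ≥0} (h : L2Le f B) : MemLp f 2 volume :=
  ⟨h.1, h.2.trans_lt ENNReal.coe_lt_top⟩

theorem L2Le.congr {f g : ℝ → ℝ} {B : ℝ≥0} (h : L2Le f B) (hfg : f =ᵐ[volume] g) : L2Le g B :=
  ⟨h.1.congr hfg, (eLpNorm_congr_ae hfg).symm.le.trans h.2⟩

theorem eLpNorm_two_eq {f : ℝ → ℝ} (h : MemLp f 2 volume) :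
    eLpNorm f 2 volume = ENNReal.ofReal (√(∫ x, f x ^ 2)) := by
  rw [h.eLpNorm_eq_integral_rpow_norm (by norm_num) (by norm_num), Real.sqrt_eq_rpow]
  simp

theorem l2Le_iff {f : ℝ → ℝ} {B : ℝ≥0} :
    L2Le f B ↔ MemLp f 2 volume ∧ ∫ x, f x ^ 2 ≤ (B : ℝ) ^ 2 := by
  refine ⟨fun h => ⟨h.memLp, ?_⟩, fun h => ⟨h.1.1, ?_⟩⟩
  · have h2 := h.2
    rw [eLpNorm_two_eq h.memLp, ENNReal.ofReal_le_iff_le_toReal ENNReal.coe_ne_top,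
      ENNReal.coe_toReal] at h2
    exact (Real.sqrt_le_left B.2).1 h2
  · rw [eLpNorm_two_eq h.1, ENNReal.ofReal_le_iff_le_toReal ENNReal.coe_ne_top,
      ENNReal.coe_toReal]
    exact (Real.sqrt_le_left B.2).2 h.2

/-- The function `f` is in the Sobolev space `H^m(ℝ)`, with `L²` norms of `f` and of its first `m`
derivatives at most `B`; for `m ≥ 1` it is the continuous representative. -/
def Sob : ℕ → (ℝ → ℝ) → ℝ≥0 → Prop
  | 0, f, B => L2Le f B
  | m + 1, f, B => L2Le f B ∧ ∃ g, IsPrim f g ∧ Sob m g B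

/-- The function `u` is in `W^{m,∞}(ℝ)`, with `u` and its first `m` derivatives bounded by `A`. -/
def Mult : ℕ → (ℝ → ℝ) → ℝ≥0 → Prop
  | 0, u, A => AEStronglyMeasurable u volume ∧ ∀ x, |u x| ≤ A
  | m + 1, u, A => (AEStronglyMeasurable u volume ∧ ∀ x, |u x| ≤ A) ∧
      ∃ v, IsPrim u v ∧ Mult m v A

theorem Sob.l2Le {m : ℕ} {f : ℝ → ℝ} {B : ℝ≥0} (h : Sob m f B) : L2Le f B := by
  cases m with
  | zero => exact h
  | succ m => exact h.1

theorem Mult.bound {m : ℕ} {u : ℝ → ℝ} {A : ℝ≥0} (h : Mult m u A) :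
    AEStronglyMeasurable u volume ∧ ∀ x, |u x| ≤ A := by
  cases m with
  | zero => exact h
  | succ m => exact h.1

theorem Sob.mono {m : ℕ} {f : ℝ → ℝ} {B B' : ℝ≥0} (h : Sob m f B) (hB : B ≤ B') : Sob m f B' := by
  induction m generalizing f with
  | zero => exact ⟨h.1, h.2.trans (by exact_mod_cast hB)⟩
  | succ m ih =>
    obtain ⟨h1, g, hg, h2⟩ := h
    exact ⟨⟨h1.1, h1.2.trans (by exact_mod_cast hB)⟩, g, hg, ih h2⟩

theorem Mult.mono {m : ℕ} {u : ℝ → ℝ} {A A' : ℝ≥0} (h : Mult m u A) (hA : A ≤ A') :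
    Mult m u A' := by
  have hA' : (A : ℝ) ≤ A' := by exact_mod_cast hA
  induction m generalizing u with
  | zero => exact ⟨h.1, fun x => (h.2 x).trans hA'⟩
  | succ m ih =>
    obtain ⟨h1, v, hv, h2⟩ := h
    exact ⟨⟨h1.1, fun x => (h1.2 x).trans hA'⟩, v, hv, ih h2⟩

theorem Sob.of_succ {m : ℕ} {f : ℝ → ℝ} {B : ℝ≥0} (h : Sob (m + 1) f B) : Sob m f B := by
  induction m generalizing f with
  | zero => exact h.1
  | succ m ih =>
    obtain ⟨h1, g, hg, h2⟩ := h
    exact ⟨h1, g, hg, ih h2⟩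

theorem Mult.of_succ {m : ℕ} {u : ℝ → ℝ} {A : ℝ≥0} (h : Mult (m + 1) u A) : Mult m u A := by
  induction m generalizing u with
  | zero => exact h.1
  | succ m ih =>
    obtain ⟨h1, v, hv, h2⟩ := h
    exact ⟨h1, v, hv, ih h2⟩

theorem L2Le.add {f g : ℝ → ℝ} {B B' : ℝ≥0} (hf : L2Le f B) (hg : L2Le g B') :
    L2Le (fun x => f x + g x) (B + B') := by
  refine ⟨hf.1.add hg.1, ?_⟩
  push_cast
  exact (eLpNorm_add_le hf.1 hg.1 (by norm_num)).trans (add_le_add hf.2 hg.2)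

theorem Sob.add {m : ℕ} {f g : ℝ → ℝ} {B B' : ℝ≥0} (hf : Sob m f B) (hg : Sob m g B') :
    Sob m (fun x => f x + g x) (B + B') := by
  induction m generalizing f g with
  | zero => exact L2Le.add hf hg
  | succ m ih =>
    obtain ⟨h1, f', hf', h2⟩ := hf
    obtain ⟨h3, g', hg', h4⟩ := hg
    exact ⟨h1.add h3, _, hf'.add hg', ih h2 h4⟩

theorem Mult.add {m : ℕ} {u v : ℝ → ℝ} {A A' : ℝ≥0} (hu : Mult m u A) (hv : Mult m v A') :
    Mult m (fun x => u x + v x) (A + A') := by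
  have key : ∀ {u v : ℝ → ℝ}, (∀ x, |u x| ≤ A) → (∀ x, |v x| ≤ A') →
      ∀ x, |u x + v x| ≤ ((A + A' : ℝ≥0) : ℝ) := fun h1 h2 x =>
    (abs_add_le _ _).trans (by push_cast; exact add_le_add (h1 x) (h2 x))
  induction m generalizing u v with
  | zero => exact ⟨hu.1.add hv.1, key hu.2 hv.2⟩
  | succ m ih =>
    obtain ⟨h1, f', hf', h2⟩ := hu
    obtain ⟨h3, g', hg', h4⟩ := hv
    exact ⟨⟨h1.1.add h3.1, key h1.2 h3.2⟩, _, hf'.add hg', ih h2 h4⟩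

theorem L2Le.bdd_mul {u f : ℝ → ℝ} {A B : ℝ≥0}
    (hu : AEStronglyMeasurable u volume ∧ ∀ x, |u x| ≤ A) (hf : L2Le f B) :
    L2Le (fun x => u x * f x) (A * B) := by
  refine ⟨hu.1.mul hf.1, ?_⟩
  push_cast
  calc eLpNorm (fun x => u x * f x) 2 volume ≤ A * eLpNorm f 2 volume := by
        refine eLpNorm_le_nnreal_smul_eLpNorm_of_ae_le_mul (Eventually.of_forall fun x => ?_) 2
        rw [nnnorm_mul]
        gcongr
        exact hu.2 x
    _ ≤ A * B := by gcongr; exact hf.2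

/-- The product rule turns one product into two at each differentiation, which accounts for the
factor `2 ^ m`. -/
theorem Mult.mul_sob {m : ℕ} {u f : ℝ → ℝ} {A B : ℝ≥0} (hu : Mult m u A) (hf : Sob m f B) :
    Sob m (fun x => u x * f x) (2 ^ m * (A * B)) := by
  induction m generalizing u f with
  | zero => simpa [Sob] using L2Le.bdd_mul hu hf
  | succ m ih =>
    have h0 := L2Le.bdd_mul hu.bound hf.l2Le
    have hu' := hu.of_succ
    have hf' := hf.of_succ
    obtain ⟨h1, v, hv, h2⟩ := hu
    obtain ⟨h3, g, hg, h4⟩ := hf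
    refine ⟨⟨h0.1, h0.2.trans ?_⟩, _, hv.mul hg, ?_⟩
    · exact ENNReal.coe_le_coe.2 (le_mul_of_one_le_left zero_le (one_le_pow₀ one_le_two))
    · have h5 := (ih h2 hf').add (ih hu' h4)
      rwa [show 2 ^ m * (A * B) + 2 ^ m * (A * B) = 2 ^ (m + 1) * (A * B) by ring] at h5

theorem Mult.mul {m : ℕ} {u v : ℝ → ℝ} {A B : ℝ≥0} (hu : Mult m u A) (hv : Mult m v B) :
    Mult m (fun x => u x * v x) (2 ^ m * (A * B)) := by
  have key : ∀ {u v : ℝ → ℝ}, (∀ x, |u x| ≤ A) → (∀ x, |v x| ≤ B) →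
      ∀ x, |u x * v x| ≤ ((A * B : ℝ≥0) : ℝ) := fun h1 h2 x => by
    rw [abs_mul]; push_cast; exact mul_le_mul (h1 x) (h2 x) (abs_nonneg _) A.2
  induction m generalizing u v with
  | zero => exact ⟨hu.1.mul hv.1, by simpa using key hu.2 hv.2⟩
  | succ m ih =>
    have hu' := hu.of_succ
    have hv' := hv.of_succ
    obtain ⟨h1, u', hp, h2⟩ := hu
    obtain ⟨h3, v', hq, h4⟩ := hv
    refine ⟨⟨h1.1.mul h3.1, fun x => (key h1.2 h3.2 x).trans ?_⟩, _, hp.mul hq, ?_⟩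
    · exact NNReal.coe_le_coe.2 (le_mul_of_one_le_left zero_le (one_le_pow₀ one_le_two))
    · have h5 := (ih h2 hv').add (ih hu' h4)
      rwa [show 2 ^ m * (A * B) + 2 ^ m * (A * B) = 2 ^ (m + 1) * (A * B) by ring] at h5

theorem mult_const (m : ℕ) (c : ℝ) : Mult m (fun _ => c) ‖c‖₊ := by
  induction m generalizing c with
  | zero => exact ⟨aestronglyMeasurable_const, fun x => le_rfl⟩
  | succ m ih =>
    exact ⟨⟨aestronglyMeasurable_const, fun x => le_rfl⟩, _, isPrim_const c,
      (ih 0).mono (by simp)⟩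

theorem Mult.neg {m : ℕ} {u : ℝ → ℝ} {A : ℝ≥0} (hu : Mult m u A) :
    Mult m (fun x => -u x) (2 ^ m * A) := by
  simpa using (mult_const m (-1)).mul hu

/-! ### Sobolev embedding on the line -/

theorem l2_mul_integrable {f g : ℝ → ℝ} (hf : MemLp f 2 volume) (hg : MemLp g 2 volume) :
    Integrable (fun x => f x * g x) :=
  hf.integrable_mul hg

theorem sobolev_sq {u w : ℝ → ℝ} (h : IsPrim u w) (hu : MemLp u 2 volume)
    (hw : MemLp w 2 volume) :
    IsPrim (fun x => u x * u x) (fun x => w x * u x + u x * w x) ∧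
      Integrable (fun x => u x * u x) ∧ Integrable (fun x => w x * u x + u x * w x) :=
  ⟨h.mul h, l2_mul_integrable hu hu, (l2_mul_integrable hw hu).add (l2_mul_integrable hu hw)⟩

/-- Integrating `(u²)' = 2uw ≤ u² + w²` from `-∞` gives `u² ≤ 2B²`; the constant `2` is a convenient
upper bound for `√2`. -/
theorem sobolev_bound {u w : ℝ → ℝ} {B : ℝ≥0} (h : IsPrim u w) (hu : L2Le u B) (hw : L2Le w B)
    (x : ℝ) : |u x| ≤ 2 * B := by
  obtain ⟨h1, h2, h3⟩ := sobolev_sq h hu.memLp hw.memLp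
  obtain ⟨hu2, huB⟩ := l2Le_iff.1 hu
  obtain ⟨hw2, hwB⟩ := l2Le_iff.1 hw
  have h4 : u x * u x ≤ (B : ℝ) ^ 2 + (B : ℝ) ^ 2 := by
    rw [← h1.integral_Iic h2 h3 x]
    calc ∫ t in Set.Iic x, (w t * u t + u t * w t)
        ≤ ∫ t in Set.Iic x, (u t ^ 2 + w t ^ 2) :=
          setIntegral_mono h3.integrableOn
            (show Integrable (fun t => u t ^ 2 + w t ^ 2) from
              hu2.integrable_sq.add hw2.integrable_sq).integrableOn
            fun t => by nlinarith [sq_nonneg (u t - w t)]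
      _ ≤ ∫ t, (u t ^ 2 + w t ^ 2) :=
          setIntegral_le_integral (hu2.integrable_sq.add hw2.integrable_sq)
            (Eventually.of_forall fun t => by positivity)
      _ = (∫ t, u t ^ 2) + ∫ t, w t ^ 2 := integral_add hu2.integrable_sq hw2.integrable_sq
      _ ≤ _ := add_le_add huB hwB
  refine abs_le_of_sq_le_sq ?_ (by positivity)
  nlinarith [sq_nonneg (B : ℝ)]

theorem tendsto_zero_of_mul_self {u : ℝ → ℝ} {l : Filter ℝ}
    (h : Tendsto (fun x => u x * u x) l (𝓝 0)) : Tendsto u l (𝓝 0) := by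
  rw [tendsto_zero_iff_abs_tendsto_zero]
  have h1 := (Real.continuous_sqrt.tendsto 0).comp h
  rw [Real.sqrt_zero] at h1
  exact h1.congr fun x => Real.sqrt_mul_self_eq_abs _

theorem Sob.continuous {m : ℕ} {f : ℝ → ℝ} {B : ℝ≥0} (h : Sob (m + 1) f B) : Continuous f := by
  obtain ⟨_, g, hg, _⟩ := h
  exact hg.continuous

theorem Sob.mult {m : ℕ} {f : ℝ → ℝ} {B : ℝ≥0} (h : Sob (m + 1) f B) : Mult m f (2 * B) := by
  have h0 : AEStronglyMeasurable f volume ∧ ∀ x, |f x| ≤ ((2 * B : ℝ≥0) : ℝ) := by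
    refine ⟨h.l2Le.1, fun x => ?_⟩
    obtain ⟨h1, g, hg, h2⟩ := h
    push_cast
    exact sobolev_bound hg h1 h2.l2Le x
  induction m generalizing f with
  | zero => exact h0
  | succ m ih =>
    obtain ⟨h1, g, hg, h2⟩ := h
    refine ⟨h0, g, hg, ih h2 ⟨h2.l2Le.1, fun x => ?_⟩⟩
    obtain ⟨h3, g', hg', h4⟩ := h2
    push_cast
    exact sobolev_bound hg' h3 h4.l2Le x

/-- Sobolev embedding of `H^{m+1}(ℝ)` into the space of `C^m` functions with bounded derivatives
that tend to zero at infinity. -/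
theorem Sob.contDiff {m : ℕ} {f : ℝ → ℝ} {B : ℝ≥0} (h : Sob (m + 1) f B) :
    ContDiff ℝ m f ∧ ∀ i ≤ m, (∀ x, |iteratedDeriv i f x| ≤ 2 * B) ∧
      Tendsto (iteratedDeriv i f) atTop (𝓝 0) ∧ Tendsto (iteratedDeriv i f) atBot (𝓝 0) := by
  have base : ∀ {f : ℝ → ℝ} {m : ℕ}, Sob (m + 1) f B → (∀ x, |f x| ≤ 2 * B) ∧
      Tendsto f atTop (𝓝 0) ∧ Tendsto f atBot (𝓝 0) := by
    intro f m h
    obtain ⟨h1, g, hg, h2⟩ := h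
    obtain ⟨h3, h4, h5⟩ := sobolev_sq hg h1.memLp h2.l2Le.memLp
    exact ⟨sobolev_bound hg h1 h2.l2Le, tendsto_zero_of_mul_self (h3.tendsto_atTop h4 h5),
      tendsto_zero_of_mul_self (h3.tendsto_atBot h4 h5)⟩
  induction m generalizing f with
  | zero =>
    refine ⟨contDiff_zero.2 h.continuous, fun i hi => ?_⟩
    obtain rfl : i = 0 := by omega
    rw [iteratedDeriv_zero]
    exact base h
  | succ m ih =>
    have hb := base h
    obtain ⟨h1, g, hg, h2⟩ := h
    obtain ⟨hc, hi⟩ := ih h2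
    -- Here `g` is itself continuous, so the almost everywhere derivative is a classical one.
    have hd : ∀ x, HasDerivAt f (g x) x := hg.hasDerivAt h2.continuous
    have hd' : deriv f = g := funext fun x => (hd x).deriv
    refine ⟨?_, fun i him => ?_⟩
    · push_cast
      rw [contDiff_succ_iff_deriv]
      exact ⟨fun x => (hd x).differentiableAt, by simp, by rwa [hd']⟩
    · cases i with
      | zero => rw [iteratedDeriv_zero]; exact hb
      | succ i =>
        rw [iteratedDeriv_succ', hd']
        exact hi i (by omega)

/-- Bounds for the sine and the cosine of a function with bounded derivatives. -/
theorem exists_trig_bound (m : ℕ) (A : ℝ≥0) : ∃ K : ℝ≥0, ∀ θ p : ℝ → ℝ, IsPrim θ p → Mult m p A →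
    Mult (m + 1) (fun x => Real.cos (θ x)) K ∧ Mult (m + 1) (fun x => Real.sin (θ x)) K := by
  have hc : ∀ θ p : ℝ → ℝ, IsPrim θ p → (AEStronglyMeasurable (fun x => Real.cos (θ x)) volume ∧
      ∀ x, |Real.cos (θ x)| ≤ 1) := fun θ p h =>
    ⟨(Real.continuous_cos.comp h.continuous).aestronglyMeasurable, fun x => Real.abs_cos_le_one _⟩
  have hs : ∀ θ p : ℝ → ℝ, IsPrim θ p → (AEStronglyMeasurable (fun x => Real.sin (θ x)) volume ∧
      ∀ x, |Real.sin (θ x)| ≤ 1) := fun θ p h =>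
    ⟨(Real.continuous_sin.comp h.continuous).aestronglyMeasurable, fun x => Real.abs_sin_le_one _⟩
  have step : ∀ (m : ℕ) (K : ℝ≥0), (∀ θ p : ℝ → ℝ, IsPrim θ p → Mult m p A →
      Mult m (fun x => Real.cos (θ x)) K ∧ Mult m (fun x => Real.sin (θ x)) K) →
      ∃ K' : ℝ≥0, ∀ θ p : ℝ → ℝ, IsPrim θ p → Mult m p A →
        Mult (m + 1) (fun x => Real.cos (θ x)) K' ∧
        Mult (m + 1) (fun x => Real.sin (θ x)) K' := by
    intro m K h
    -- The three entries bound the functions themselves, the derivative `cos θ · p` of the sine, and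
    -- the derivative `-sin θ · p` of the cosine, where the sign costs another `2 ^ m`.
    set K' : ℝ≥0 := max 1 (max (2 ^ m * (K * A)) (2 ^ m * ((2 ^ m * K) * A)))
    have h1 : (1 : ℝ) ≤ K' := by exact_mod_cast le_max_left _ _
    refine ⟨K', fun θ p hp hm => ?_⟩
    obtain ⟨h2, h3⟩ := h θ p hp hm
    exact ⟨⟨⟨(hc θ p hp).1, fun x => ((hc θ p hp).2 x).trans h1⟩, _, hp.cos,
        (h3.neg.mul hm).mono ((le_max_right _ _).trans (le_max_right _ _))⟩,
      ⟨⟨(hs θ p hp).1, fun x => ((hs θ p hp).2 x).trans h1⟩, _, hp.sin,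
        (h2.mul hm).mono ((le_max_left _ _).trans (le_max_right _ _))⟩⟩
  induction m with
  | zero => exact step 0 1 fun θ p hp _ => ⟨by simpa [Mult] using hc θ p hp,
      by simpa [Mult] using hs θ p hp⟩
  | succ m ih =>
    obtain ⟨K, hK⟩ := ih
    exact step (m + 1) K fun θ p hp hm => hK θ p hp hm.of_succ

/-! ### The `L²` Fourier transform and differentiation -/

open scoped SchwartzMap ComplexConjugate

/-- The `L²` transform agrees with the distributional one, so identities between transforms can be
tested on Schwartz functions. -/
theorem fourier_pairing (F : Lp ℂ 2 (volume : Measure ℝ)) (ψ : 𝓢(ℝ, ℂ)) :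
    ∫ ξ, ψ ξ * (𝓕 F : Lp ℂ 2 (volume : Measure ℝ)) ξ = ∫ x, (𝓕 ψ : 𝓢(ℝ, ℂ)) x * F x := by
  have h := congrArg (fun T => T ψ) (Lp.fourier_toTemperedDistribution_eq F)
  simp only [Lp.toTemperedDistribution_apply, TemperedDistribution.fourier_apply] at h
  simpa using h.symm

theorem exists_schwartz_mul (ψ : 𝓢(ℝ, ℂ)) : ∃ χ : 𝓢(ℝ, ℂ),
    (∀ ξ, χ ξ = 2 * Real.pi * Complex.I * ξ * ψ ξ) ∧ ∀ x, (𝓕 χ : 𝓢(ℝ, ℂ)) x = -deriv (𝓕 ψ : 𝓢(ℝ, ℂ)) x := by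
  have ht : (fun ξ : ℝ => 2 * Real.pi * Complex.I * (ξ : ℂ)).HasTemperateGrowth := by fun_prop
  set χ := SchwartzMap.smulLeftCLM ℂ (fun ξ : ℝ => 2 * Real.pi * Complex.I * (ξ : ℂ)) ψ with hχ
  have h1 : ∀ ξ, χ ξ = 2 * Real.pi * Complex.I * ξ * ψ ξ := fun ξ => by
    rw [hχ, SchwartzMap.smulLeftCLM_apply_apply ht, smul_eq_mul]
  refine ⟨χ, h1, fun x => ?_⟩
  have h2 : Integrable (fun x : ℝ => x • ψ x) := by
    have h3 := (χ.integrable (μ := volume)).const_mul (2 * Real.pi * Complex.I)⁻¹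
    refine h3.congr (Eventually.of_forall fun x => ?_)
    have : (2 * Real.pi * Complex.I : ℂ) ≠ 0 := by simp [Real.pi_ne_zero]
    simp only [h1, Complex.real_smul]
    field_simp
  have h4 := Real.deriv_fourier ψ.integrable h2
  rw [SchwartzMap.fourier_coe, SchwartzMap.fourier_coe, h4, ← Pi.neg_apply (𝓕 _) x]
  simp only [Real.fourier_eq, Pi.neg_apply, ← integral_neg]
  congr 1
  funext v
  rw [h1, ← smul_neg]
  congr 1
  simp only [smul_eq_mul]
  ring

theorem integral_schwartz_by_parts {u w : ℝ → ℝ} (h : IsPrim u w) (hu : MemLp u 2 volume)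
    (hw : MemLp w 2 volume) (Φ : 𝓢(ℝ, ℂ)) :
    ∫ x, Φ x * w x = ∫ x, -deriv Φ x * u x := by
  have hΦ : MemLp (fun x => Φ x) 2 volume := Φ.memLp 2
  have hΦ' : MemLp (deriv Φ) 2 volume := by
    have h1 : ⇑(SchwartzMap.derivCLM ℂ ℂ Φ) = deriv Φ := funext fun x => by simp
    rw [← h1]
    exact (SchwartzMap.derivCLM ℂ ℂ Φ).memLp 2
  have hd : ∀ x, HasDerivAt Φ (deriv Φ x) x := fun x => Φ.differentiableAt.hasDerivAt
  have hdc : Continuous (deriv Φ) := (SchwartzMap.derivCLM ℂ ℂ Φ).continuous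
  have hu' : MemLp (fun x => (u x : ℂ)) 2 volume := hu.ofReal
  have hw' : MemLp (fun x => (w x : ℂ)) 2 volume := hw.ofReal
  have i1 : Integrable (fun x => Φ x * w x) := hΦ.integrable_mul hw'
  have i2 : Integrable (fun x => deriv Φ x * u x) := hΦ'.integrable_mul hu'
  -- The real integration by parts is applied to the real and imaginary parts of `Φ` separately.
  have key : ∀ L : ℂ →L[ℝ] ℝ, (∀ (z : ℂ) (r : ℝ), L (z * r) = L z * r) →
      L (∫ x, (Φ x * w x + deriv Φ x * u x)) = 0 := by
    intro L hL
    have i3 : Integrable (fun x => Φ x * w x + deriv Φ x * u x) volume := i1.add i2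
    rw [← L.integral_comp_comm i3]
    have hp : IsPrim (fun x => L (Φ x)) (fun x => L (deriv Φ x)) :=
      isPrim_of_hasDerivAt (fun x => L.hasFDerivAt.comp_hasDerivAt x (hd x))
        (L.continuous.comp hdc)
    have m1 : MemLp (fun x => L (Φ x)) 2 volume := L.comp_memLp' hΦ
    have m2 : MemLp (fun x => L (deriv Φ x)) 2 volume := L.comp_memLp' hΦ'
    rw [← (hp.mul h).integral_eq_zero (l2_mul_integrable m1 hu)
      ((l2_mul_integrable m2 hu).add (l2_mul_integrable m1 hw))]
    congr 1
    funext x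
    rw [map_add, hL, hL, add_comm]
  have h0 : ∫ x, (Φ x * w x + deriv Φ x * u x) = 0 := by
    apply Complex.ext
    · exact key Complex.reCLM fun z r => by simp
    · exact key Complex.imCLM fun z r => by simp
  rw [integral_add i1 i2] at h0
  simp only [neg_mul]
  rw [integral_neg]
  exact eq_neg_of_add_eq_zero_left h0

theorem lp_locallyIntegrable (F : Lp ℂ 2 (volume : Measure ℝ)) : LocallyIntegrable F volume :=
  (Lp.memLp F).locallyIntegrable (by norm_num)

theorem LocallyIntegrable.mul_of_continuous {F : ℝ → ℂ} {c : ℝ → ℂ} (hF : LocallyIntegrable F)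
    (hc : Continuous c) : LocallyIntegrable (fun x => c x * F x) := by
  rw [← locallyIntegrableOn_univ] at hF ⊢
  exact hF.continuousOn_mul hc.continuousOn isOpen_univ.isLocallyClosed

/-- The Schwartz function given by a real test function. -/
noncomputable def schwartzOfReal {φ : ℝ → ℝ} (hφ : ContDiff ℝ ∞ φ) (hc : HasCompactSupport φ) :
    𝓢(ℝ, ℂ) :=
  HasCompactSupport.toSchwartzMap (f := fun x => (φ x : ℂ)) (hc.comp_left Complex.ofReal_zero)
    (Complex.ofRealCLM.contDiff.comp hφ)

@[simp]
theorem schwartzOfReal_apply {φ : ℝ → ℝ} (hφ : ContDiff ℝ ∞ φ) (hc : HasCompactSupport φ) (x : ℝ) :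
    schwartzOfReal hφ hc x = φ x := rfl

theorem coeFn_toLp_mul_integral {v : ℝ → ℝ} (hv : MemLp (fun x => (v x : ℂ)) 2 volume)
    (Φ : ℝ → ℂ) : ∫ x, Φ x * (hv.toLp _) x = ∫ x, Φ x * v x := by
  refine integral_congr_ae ?_
  filter_upwards [hv.coeFn_toLp] with x hx
  rw [hx]

/-- The Fourier transform of the derivative of an `H¹` function. -/
theorem IsPrim.fourier_eq {u w : ℝ → ℝ} (h : IsPrim u w) (hu : MemLp (fun x => (u x : ℂ)) 2 volume)
    (hw : MemLp (fun x => (w x : ℂ)) 2 volume) :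
    ∀ᵐ ξ : ℝ, (𝓕 (hw.toLp _) : Lp ℂ 2 (volume : Measure ℝ)) ξ =
      2 * Real.pi * Complex.I * ξ * (𝓕 (hu.toLp _) : Lp ℂ 2 (volume : Measure ℝ)) ξ := by
  refine ae_eq_of_integral_contDiff_smul_eq (lp_locallyIntegrable _)
    (LocallyIntegrable.mul_of_continuous (lp_locallyIntegrable _) (by fun_prop)) fun φ hφ hc => ?_
  obtain ⟨χ, h1, h2⟩ := exists_schwartz_mul (schwartzOfReal hφ hc)
  have h3 := fourier_pairing (hw.toLp _) (schwartzOfReal hφ hc)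
  have h4 := fourier_pairing (hu.toLp _) χ
  rw [coeFn_toLp_mul_integral] at h3 h4
  simp only [schwartzOfReal_apply] at h3
  simp only [Complex.real_smul]
  rw [h3, integral_schwartz_by_parts h (by simpa using hu.re) (by simpa using hw.re)]
  simp only [← h2]
  rw [← h4]
  congr 1
  funext ξ
  rw [h1, schwartzOfReal_apply]
  ring

/-- A function whose Fourier transform times `2πiξ` is in `L²` is the primitive of an `L²`
function. -/
theorem exists_isPrim_of_fourier {u w : ℝ → ℝ} (hu : MemLp (fun x => (u x : ℂ)) 2 volume)
    (hw : MemLp (fun x => (w x : ℂ)) 2 volume)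
    (h : ∀ᵐ ξ : ℝ, (𝓕 (hw.toLp _) : Lp ℂ 2 (volume : Measure ℝ)) ξ =
      2 * Real.pi * Complex.I * ξ * (𝓕 (hu.toLp _) : Lp ℂ 2 (volume : Measure ℝ)) ξ) :
    ∃ u', u' =ᵐ[volume] u ∧ IsPrim u' w := by
  have hu' : MemLp u 2 volume := by simpa using hu.re
  have hw' : MemLp w 2 volume := by simpa using hw.re
  refine exists_isPrim_of_weak (hu'.locallyIntegrable (by norm_num))
    (hw'.locallyIntegrable (by norm_num)) fun φ hφ hc => ?_
  set Φ := schwartzOfReal hφ hc with hΦ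
  -- Testing with the inverse transform of `Φ` makes the pairing on the physical side involve `φ`
  -- itself.
  obtain ⟨χ, h1, h2⟩ := exists_schwartz_mul (𝓕⁻ Φ : 𝓢(ℝ, ℂ))
  have h3 := fourier_pairing (hw.toLp _) (𝓕⁻ Φ : 𝓢(ℝ, ℂ))
  have h4 := fourier_pairing (hu.toLp _) χ
  rw [coeFn_toLp_mul_integral] at h3 h4
  rw [fourier_fourierInv_eq] at h2 h3
  have hd : ∀ x, deriv (schwartzOfReal hφ hc) x = ((deriv φ x : ℝ) : ℂ) := fun x =>
    ((hφ.differentiable (by simp) x).hasDerivAt.ofReal_comp).deriv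
  have h5 : ∫ ξ, χ ξ * (𝓕 (hu.toLp _) : Lp ℂ 2 (volume : Measure ℝ)) ξ =
      ∫ ξ, (𝓕⁻ Φ : 𝓢(ℝ, ℂ)) ξ * (𝓕 (hw.toLp _) : Lp ℂ 2 (volume : Measure ℝ)) ξ := by
    refine integral_congr_ae ?_
    filter_upwards [h] with ξ hξ
    rw [hξ, h1]; ring
  rw [h3, h4] at h5
  simp only [h2, hd, hΦ, schwartzOfReal_apply] at h5
  have h6 : ∫ x, -(deriv φ x * u x) = ∫ x, φ x * w x := by
    have h7 : ((∫ x, -(deriv φ x * u x) : ℝ) : ℂ) = ((∫ x, φ x * w x : ℝ) : ℂ) := by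
      rw [← integral_complex_ofReal, ← integral_complex_ofReal]
      push_cast
      simpa only [neg_mul] using h5
    exact_mod_cast h7
  have i1 : Integrable (fun x => u x * deriv φ x) := by
    simpa [mul_comm] using (hu'.locallyIntegrable (by norm_num)
      ).integrable_smul_left_of_hasCompactSupport (hφ.continuous_deriv (by simp)) hc.deriv
  have i2 : Integrable (fun x => w x * φ x) := by
    simpa [mul_comm] using (hw'.locallyIntegrable (by norm_num)
      ).integrable_smul_left_of_hasCompactSupport hφ.continuous hc
  rw [integral_add i1 i2]
  rw [integral_neg] at h6
  simp only [mul_comm (u _), mul_comm (w _)]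
  linarith

/-! ### Hermitian symmetry and real-valuedness -/

theorem conj_fourierIntegral_ofReal (φ : ℝ → ℝ) (x : ℝ) :
    conj (𝓕 (fun y => (φ y : ℂ)) x) = 𝓕 (fun y => (φ y : ℂ)) (-x) := by
  rw [Real.fourier_eq', Real.fourier_eq', ← integral_conj]
  congr 1
  funext v
  simp only [smul_eq_mul, map_mul, Complex.conj_ofReal, ← Complex.exp_conj, Complex.conj_I,
    inner_neg_right]
  push_cast
  ring_nf

/-- The Fourier transform of a real function is Hermitian. -/
theorem conj_fourier_ofReal {f : ℝ → ℝ} (hf : MemLp (fun x => (f x : ℂ)) 2 volume) :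
    ∀ᵐ ξ : ℝ, conj ((𝓕 (hf.toLp _) : Lp ℂ 2 (volume : Measure ℝ)) ξ) =
      (𝓕 (hf.toLp _) : Lp ℂ 2 (volume : Measure ℝ)) (-ξ) := by
  set F := (𝓕 (hf.toLp _) : Lp ℂ 2 (volume : Measure ℝ)) with hF
  have l1 : LocallyIntegrable (fun ξ => conj (F ξ)) volume :=
    ((Lp.memLp F).star).locallyIntegrable (by norm_num)
  have l2 : LocallyIntegrable (fun ξ => F (-ξ)) volume :=
    ((Lp.memLp F).comp_measurePreserving
      (Measure.measurePreserving_neg volume)).locallyIntegrable (by norm_num)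
  refine ae_eq_of_integral_contDiff_smul_eq l1 l2 fun φ hφ hc => ?_
  have hφn : ContDiff ℝ ∞ (fun x => φ (-x)) := hφ.comp contDiff_neg
  have hcn : HasCompactSupport (fun x => φ (-x)) := hc.comp_homeomorph (Homeomorph.neg ℝ)
  have h1 := fourier_pairing (hf.toLp _) (schwartzOfReal hφ hc)
  have h2 := fourier_pairing (hf.toLp _) (schwartzOfReal hφn hcn)
  rw [coeFn_toLp_mul_integral] at h1 h2
  rw [← hF] at h1 h2
  have h3 : ∀ x, (𝓕 (schwartzOfReal hφn hcn) : 𝓢(ℝ, ℂ)) x = conj ((𝓕 (schwartzOfReal hφ hc) : 𝓢(ℝ, ℂ)) x) := fun x => by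
    rw [SchwartzMap.fourier_coe, SchwartzMap.fourier_coe]
    refine Eq.trans ?_ (conj_fourierIntegral_ofReal φ x).symm
    rw [Real.fourier_eq', Real.fourier_eq', ← integral_neg_eq_self]
    congr 1
    funext v
    simp
  simp only [Complex.real_smul]
  calc ∫ ξ, (φ ξ : ℂ) * conj (F ξ) = conj (∫ ξ, (φ ξ : ℂ) * F ξ) := by
        rw [← integral_conj]; simp
    _ = ∫ x, (𝓕 (schwartzOfReal hφn hcn) : 𝓢(ℝ, ℂ)) x * f x := by
        simp only [schwartzOfReal_apply] at h1
        rw [h1, ← integral_conj]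
        simp [h3]
    _ = ∫ ξ, (φ (-ξ) : ℂ) * F ξ := by rw [← h2]; simp
    _ = ∫ ξ, (φ ξ : ℂ) * F (-ξ) := by rw [← integral_neg_eq_self]; simp

/-- A function with Hermitian Fourier transform is real. -/
theorem im_eq_zero_of_conj_fourier (V : Lp ℂ 2 (volume : Measure ℝ))
    (h : ∀ᵐ ξ : ℝ, conj ((𝓕 V : Lp ℂ 2 (volume : Measure ℝ)) ξ) =
      (𝓕 V : Lp ℂ 2 (volume : Measure ℝ)) (-ξ)) : ∀ᵐ x : ℝ, (V x).im = 0 := by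
  refine ae_eq_zero_of_integral_contDiff_smul_eq_zero
    ((Lp.memLp V).im.locallyIntegrable (by norm_num)) fun φ hφ hc => ?_
  set Φ := schwartzOfReal hφ hc with hΦ
  set F := (𝓕 V : Lp ℂ 2 (volume : Measure ℝ)) with hF
  have h1 := fourier_pairing V (𝓕⁻ Φ : 𝓢(ℝ, ℂ))
  rw [fourier_fourierInv_eq, ← hF] at h1
  have h2 : ∀ ξ, conj ((𝓕⁻ Φ : 𝓢(ℝ, ℂ)) ξ) = (𝓕⁻ Φ : 𝓢(ℝ, ℂ)) (-ξ) := fun ξ => by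
    rw [SchwartzMap.fourierInv_coe, Real.fourierInv_eq_fourier_neg,
      Real.fourierInv_eq_fourier_neg]
    exact conj_fourierIntegral_ofReal φ (-ξ)
  -- By Hermitian symmetry, conjugation only reflects `ξ`; hence the pairing of `V` with any real
  -- test function is real.
  have h3 : conj (∫ ξ, (𝓕⁻ Φ : 𝓢(ℝ, ℂ)) ξ * F ξ) = ∫ ξ, (𝓕⁻ Φ : 𝓢(ℝ, ℂ)) ξ * F ξ := by
    rw [← integral_conj, ← integral_neg_eq_self (fun ξ => (𝓕⁻ Φ : 𝓢(ℝ, ℂ)) ξ * F ξ)]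
    refine integral_congr_ae ?_
    filter_upwards [h] with ξ hξ
    rw [map_mul, h2, hξ]
  rw [h1] at h3
  have h4 := Complex.conj_eq_iff_im.1 h3
  have hi : Integrable (fun x => Φ x * V x) := (Φ.memLp 2).integrable_mul (Lp.memLp V)
  have h5 := Complex.imCLM.integral_comp_comm hi
  rw [Complex.imCLM_apply, h4] at h5
  rw [← h5]
  congr 1
  funext x
  simp [hΦ]

/-! ### The operator with symbol `|k|` on Sobolev functions -/

/-- The real function `v ∈ L²` has the Fourier transform `|k|` times that of `f ∈ L²`. -/
def IsAbsDeriv (f v : ℝ → ℝ) : Prop :=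
  ∃ (hf : MemLp (fun x => (f x : ℂ)) 2 (volume : Measure ℝ))
    (hv : MemLp (fun x => (v x : ℂ)) 2 (volume : Measure ℝ)),
    ∀ᵐ ξ : ℝ, (𝓕 (hv.toLp _) : Lp ℂ 2 (volume : Measure ℝ)) ξ =
      ((2 * Real.pi * |ξ| : ℝ) : ℂ) * (𝓕 (hf.toLp _) : Lp ℂ 2 (volume : Measure ℝ)) ξ

theorem norm_two_pi_I_mul (ξ : ℝ) (z : ℂ) :
    ‖((2 * Real.pi * |ξ| : ℝ) : ℂ) * z‖ = ‖2 * Real.pi * Complex.I * ξ * z‖ := by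
  simp [abs_of_pos Real.pi_pos]

/-- The symbols `|k|` and `ik` have equal modulus, so `|k| f̂` is in `L²` because `f'` is. Its
inverse transform is real because `|k|` is real and even. -/
theorem exists_isAbsDeriv {f g : ℝ → ℝ} (h : IsPrim f g) (hf : MemLp f 2 volume)
    (hg : MemLp g 2 volume) : ∃ v, IsAbsDeriv f v := by
  have hf' : MemLp (fun x => (f x : ℂ)) 2 (volume : Measure ℝ) := hf.ofReal
  have hg' : MemLp (fun x => (g x : ℂ)) 2 (volume : Measure ℝ) := hg.ofReal
  have hfg := h.fourier_eq hf' hg'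
  have hs := conj_fourier_ofReal hf'
  set F := (𝓕 (hf'.toLp _) : Lp ℂ 2 (volume : Measure ℝ)) with hF
  set G := (𝓕 (hg'.toLp _) : Lp ℂ 2 (volume : Measure ℝ)) with hG
  have hM : MemLp (fun ξ : ℝ => ((2 * Real.pi * |ξ| : ℝ) : ℂ) * F ξ) 2 volume := by
    refine (Lp.memLp G).of_le ?_ ?_
    · exact (Continuous.aestronglyMeasurable (by fun_prop)).mul (Lp.memLp F).1
    · filter_upwards [hfg] with ξ hξ
      rw [hξ, norm_two_pi_I_mul]
  set V : Lp ℂ 2 (volume : Measure ℝ) := 𝓕⁻ (hM.toLp _) with hV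
  have hFV : (𝓕 V : Lp ℂ 2 (volume : Measure ℝ)) = hM.toLp _ := fourier_fourierInv_eq _
  have hFV' : ∀ᵐ ξ : ℝ, (𝓕 V : Lp ℂ 2 (volume : Measure ℝ)) ξ =
      ((2 * Real.pi * |ξ| : ℝ) : ℂ) * F ξ := by
    rw [hFV]; exact hM.coeFn_toLp
  have hr := im_eq_zero_of_conj_fourier V (by
    have hn := (Measure.measurePreserving_neg
      (volume : Measure ℝ)).quasiMeasurePreserving.ae hFV'
    filter_upwards [hFV', hn, hs] with ξ h1 h2 h3
    rw [h1, h2, map_mul, h3, Complex.conj_ofReal, abs_neg])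
  have hv : MemLp (fun x => (((V x).re : ℝ) : ℂ)) 2 (volume : Measure ℝ) :=
    (Lp.memLp V).re.ofReal
  refine ⟨fun x => (V x).re, hf', hv, ?_⟩
  have hvV : hv.toLp _ = V := by
    refine Lp.ext ?_
    filter_upwards [hv.coeFn_toLp, hr] with x h1 h2
    rw [h1]
    exact Complex.ext (by simp) (by simp [h2])
  rw [hvV]
  exact hFV'

theorem eLpNorm_ofReal (f : ℝ → ℝ) :
    eLpNorm (fun x => (f x : ℂ)) 2 (volume : Measure ℝ) = eLpNorm f 2 volume :=
  eLpNorm_congr_norm_ae (Eventually.of_forall fun x => by simp)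

theorem eLpNorm_fourier {f : ℝ → ℝ} (hf : MemLp (fun x => (f x : ℂ)) 2 (volume : Measure ℝ)) :
    eLpNorm (𝓕 (hf.toLp _) : Lp ℂ 2 (volume : Measure ℝ)) 2 volume = eLpNorm f 2 volume := by
  rw [← Lp.enorm_def, ← eLpNorm_ofReal, ← eLpNorm_congr_ae hf.coeFn_toLp, ← Lp.enorm_def,
    enorm_eq_iff_norm_eq, Lp.norm_fourier_eq]

theorem IsAbsDeriv.l2Le {f g v : ℝ → ℝ} {B : ℝ≥0} (hv : IsAbsDeriv f v) (h : IsPrim f g)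
    (hg : L2Le g B) : L2Le v B := by
  obtain ⟨hf', hv', hfv⟩ := hv
  have hg' : MemLp (fun x => (g x : ℂ)) 2 (volume : Measure ℝ) := hg.memLp.ofReal
  have hfg := h.fourier_eq hf' hg'
  have hvm : MemLp v 2 volume := by simpa using hv'.re
  refine ⟨hvm.1, ?_⟩
  rw [← eLpNorm_fourier hv']
  refine le_trans (le_of_eq ?_) hg.2
  rw [← eLpNorm_fourier hg']
  refine eLpNorm_congr_norm_ae ?_
  filter_upwards [hfv, hfg] with ξ h1 h2
  rw [h1, h2, norm_two_pi_I_mul]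

/-- The operator `(-d²/dx²)^{1/2}` loses one derivative in the Sobolev scale. -/
theorem IsAbsDeriv.exists_sob {m : ℕ} {f v : ℝ → ℝ} {B : ℝ≥0} (hv : IsAbsDeriv f v)
    (hf : Sob (m + 1) f B) : ∃ v', v' =ᵐ[volume] v ∧ Sob m v' B := by
  induction m generalizing f v with
  | zero =>
    obtain ⟨h1, g, hg, h2⟩ := hf
    exact ⟨v, EventuallyEq.rfl, hv.l2Le hg h2⟩
  | succ m ih =>
    obtain ⟨h1, g, hg, h2⟩ := hf
    obtain ⟨g', hg', h3⟩ := h2.2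
    -- Fourier multipliers commute: the derivative of `|D| f` is `w = |D| f'`, to which the
    -- induction hypothesis applies.
    obtain ⟨w, hw⟩ := exists_isAbsDeriv hg' h2.l2Le.memLp h3.l2Le.memLp
    obtain ⟨w', hww', hw'⟩ := ih hw h2
    have hvB := hv.l2Le hg h2.l2Le
    obtain ⟨hfm, hvm, hfv⟩ := hv
    obtain ⟨hgm, hwm, hgw⟩ := hw
    have hfg := hg.fourier_eq hfm hgm
    obtain ⟨v', hv', hp⟩ := exists_isPrim_of_fourier hvm hwm (by
      filter_upwards [hfv, hgw, hfg] with ξ h4 h5 h6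
      rw [h4, h5, h6]; ring)
    exact ⟨v', hv', hvB.congr hv'.symm, w', hp.congr hww'.symm, hw'⟩

/-- By Plancherel the integral equals `∫ |k| |f̂|²`. -/
theorem IsAbsDeriv.integral_mul_nonneg {f v : ℝ → ℝ} (hv : IsAbsDeriv f v) :
    0 ≤ ∫ x, f x * v x := by
  obtain ⟨hf, hv, h⟩ := hv
  have h1 := Lp.inner_fourier_eq (hf.toLp _) (hv.toLp _)
  rw [L2.inner_def, L2.inner_def] at h1
  have h2 : ∫ x, inner ℂ ((hf.toLp _) x) ((hv.toLp _) x) = ((∫ x, f x * v x : ℝ) : ℂ) := by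
    rw [← integral_complex_ofReal]
    refine integral_congr_ae ?_
    filter_upwards [hf.coeFn_toLp, hv.coeFn_toLp] with x h3 h4
    rw [h3, h4]
    simp [mul_comm]
  set F := (𝓕 (hf.toLp _) : Lp ℂ 2 (volume : Measure ℝ)) with hF
  have h3 : ∫ ξ, inner ℂ (F ξ) ((𝓕 (hv.toLp _) : Lp ℂ 2 (volume : Measure ℝ)) ξ) =
      ((∫ ξ, 2 * Real.pi * |ξ| * ‖F ξ‖ ^ 2 : ℝ) : ℂ) := by
    rw [← integral_complex_ofReal]
    refine integral_congr_ae ?_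
    filter_upwards [h] with ξ h4
    rw [h4, RCLike.inner_apply, mul_assoc, Complex.mul_conj, Complex.normSq_eq_norm_sq]
    push_cast
    ring
  rw [h2, h3] at h1
  rw [← Complex.ofReal_inj.1 h1]
  exact integral_nonneg fun ξ => by
    have := Real.pi_pos
    positivity

/-- Since constants are ignored, the term `|D| sin θ` of the equation can be computed from `sin θ -
h`, which is in `L²`. -/
theorem halfLaplacian_ae_eq {f v : ℝ → ℝ} {c : ℝ} (h : IsAbsDeriv (fun x => f x - c) v) :
    halfLaplacian f =ᵐ[volume] v := by
  have h1 : IsHalfLaplacian f v := ⟨c, h⟩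
  have h2 : ∃ v, IsHalfLaplacian f v := ⟨v, h1⟩
  rw [halfLaplacian, dif_pos h2]
  exact h2.choose_spec.ae_unique h1

/-! ### Energy bound and bootstrap for the Euler–Lagrange equation -/

theorem MemH1Loc.isPrim {θ : ℝ → ℝ} (h : MemH1Loc θ) : IsPrim θ (deriv θ) :=
  ⟨fun a b => (h a b).1, EventuallyEq.rfl⟩

theorem IsPrim.sin_sub {θ p : ℝ → ℝ} (h : IsPrim θ p) (c : ℝ) :
    IsPrim (fun x => Real.sin (θ x) - c) (fun x => Real.cos (θ x) * p x) := by
  simpa [sub_eq_add_neg] using h.sin.add (isPrim_const (-c))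

theorem continuous_cos_bound {θ p : ℝ → ℝ} (h : IsPrim θ p) :
    Mult 0 (fun x => Real.cos (θ x)) 1 :=
  ⟨(Real.continuous_cos.comp h.continuous).aestronglyMeasurable,
    fun x => by simpa using Real.abs_cos_le_one _⟩

/-- The energy controls the `L²` norms of `θ'` and of `sin θ - h`. -/
theorem l2Le_of_energy {ν h : ℝ} {θ : ℝ → ℝ} (hν : 0 < ν) (hθ : MemH1Loc θ)
    (hE : energy ν h θ < ⊤) :
    L2Le (deriv θ) (NNReal.sqrt (2 * (energy ν h θ).toNNReal)) ∧
      L2Le (fun x => Real.sin (θ x) - h) (NNReal.sqrt (2 * (energy ν h θ).toNNReal)) := by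
  have hm : MemLp (deriv θ) 2 volume ∧ MemLp (fun x => Real.sin (θ x) - h) 2 volume := by
    by_contra hn
    rw [energy, if_neg hn] at hE
    exact lt_irrefl _ hE
  have hE' := hE
  rw [energy, if_pos hm] at hE'
  obtain ⟨h1, h2⟩ := hm
  have hp := hθ.isPrim.sin_sub h
  have h0 := L2Le.bdd_mul (continuous_cos_bound hθ.isPrim)
    (show L2Le (deriv θ) (eLpNorm (deriv θ) 2 volume).toNNReal from
      ⟨h1.1, (ENNReal.coe_toNNReal h1.2.ne).symm.le⟩)
  obtain ⟨v, hv⟩ := exists_isAbsDeriv hp h2 h0.memLp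
  have hae : halfLaplacian (fun y => Real.sin (θ y) - h) =ᵐ[volume] v :=
    halfLaplacian_ae_eq (c := 0) (by simpa using hv)
  have hvm : MemLp v 2 volume := (hv.l2Le hp h0).memLp
  set f : ℝ → ℝ := fun x => Real.sin (θ x) - h with hf
  have hint : ∫ x, ((deriv θ x) ^ 2 + (Real.sin (θ x) - h) ^ 2 +
      (ν / 2) * ((Real.sin (θ x) - h) * halfLaplacian f x)) =
      (∫ x, deriv θ x ^ 2) + (∫ x, f x ^ 2) + (ν / 2) * ∫ x, f x * v x := by
    have i1 : Integrable (fun x => deriv θ x ^ 2 + f x ^ 2) volume :=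
      h1.integrable_sq.add h2.integrable_sq
    rw [← integral_add h1.integrable_sq h2.integrable_sq, ← integral_const_mul,
      ← integral_add i1 ((l2_mul_integrable h2 hvm).const_mul _)]
    refine integral_congr_ae ?_
    filter_upwards [hae] with x hx
    rw [hx]
  have hvn := hv.integral_mul_nonneg
  have n1 : 0 ≤ ∫ x, deriv θ x ^ 2 := integral_nonneg fun x => sq_nonneg _
  have n2 : 0 ≤ ∫ x, f x ^ 2 := integral_nonneg fun x => sq_nonneg _
  have n3 : 0 ≤ (ν / 2) * ∫ x, f x * v x := mul_nonneg (by positivity) hvn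
  have he : ((energy ν h θ).toNNReal : ℝ) = (1 / 2) * ((∫ x, deriv θ x ^ 2) + (∫ x, f x ^ 2) +
      (ν / 2) * ∫ x, f x * v x) := by
    rw [energy, if_pos ⟨h1, h2⟩, hint]
    exact ENNReal.toReal_ofReal (by positivity)
  have hs : ((NNReal.sqrt (2 * (energy ν h θ).toNNReal) : ℝ≥0) : ℝ) ^ 2 =
      2 * ((energy ν h θ).toNNReal : ℝ) := by
    have := NNReal.sq_sqrt (2 * (energy ν h θ).toNNReal)
    exact_mod_cast this
  -- Each of the three nonnegative terms is at most their sum, which is `2E`.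
  refine ⟨l2Le_iff.2 ⟨h1, ?_⟩, l2Le_iff.2 ⟨h2, ?_⟩⟩ <;> rw [hs, he] <;> linarith

/-- The bound in `H^{m+1}` that the Euler–Lagrange equation gives for `θ'` from the bound `B` in
`H^m` and the bound `K` for `cos θ` in `W^{m,∞}`. -/
noncomputable def bootstrapBound (ν : ℝ) (m : ℕ) (B K : ℝ≥0) : ℝ≥0 :=
  B + 2 ^ m * (K * ((B + 2 ^ m * (K * B)) + 2 ^ m * (‖ν / 2‖₊ * (B + 2 ^ m * (K * B)))))

/-- One step of the regularity bootstrap for the Euler–Lagrange equation. -/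
theorem IsWeakSolution.exists_sob_succ {ν h : ℝ} {θ p : ℝ → ℝ} (hw : IsWeakSolution ν h θ)
    (hp : IsPrim θ p) {m : ℕ} {B K : ℝ≥0} (hpB : Sob m p B)
    (hK : Mult m (fun x => Real.cos (θ x)) K)
    (hf : L2Le (fun x => Real.sin (θ x) - h) B) :
    ∃ p', IsPrim θ p' ∧ Sob (m + 1) p' (bootstrapBound ν m B K) := by
  -- `D` bounds `sin θ - h` in `H^{m+1}`: `B` for the function, the rest for its derivative `cos θ ·
  -- p`.
  set D : ℝ≥0 := B + 2 ^ m * (K * B) with hD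
  have hfp := hp.sin_sub h
  have hfS : Sob (m + 1) (fun x => Real.sin (θ x) - h) D :=
    ⟨⟨hf.1, hf.2.trans (ENNReal.coe_le_coe.2 (le_add_of_nonneg_right zero_le))⟩, _, hfp,
      (hK.mul_sob hpB).mono (le_add_of_nonneg_left zero_le)⟩
  obtain ⟨v, hv⟩ := exists_isAbsDeriv hfp hf.memLp (hK.mul_sob hpB).l2Le.memLp
  obtain ⟨v', hv', hvS⟩ := hv.exists_sob hfS
  have hae : halfLaplacian (fun y => Real.sin (θ y)) =ᵐ[volume] v := halfLaplacian_ae_eq hv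
  -- This is the `H^m` bound for the right-hand side of `θ'' = …`; the weak equation identifies that
  -- function as the weak derivative of `p`.
  have hg := hK.mul_sob (hfS.of_succ.add ((mult_const m (ν / 2)).mul_sob hvS))
  obtain ⟨p', hp', hpg⟩ := exists_isPrim_of_weak
    (hpB.l2Le.memLp.locallyIntegrable (by norm_num))
    (hg.l2Le.memLp.locallyIntegrable (by norm_num)) fun φ hφ hc => by
      rw [← hw φ hφ hc]
      refine integral_congr_ae ?_
      filter_upwards [hae, hv', hp.deriv_ae] with x h1 h2 h3
      rw [h1, h2, h3]
      ring
  refine ⟨p', hp.congr hp'.symm, ?_, _, hpg, hg.mono (le_add_of_nonneg_left zero_le)⟩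
  have h1 := hpB.l2Le.congr hp'.symm
  exact ⟨h1.1, h1.2.trans (ENNReal.coe_le_coe.2 (le_add_of_nonneg_right zero_le))⟩

/-- Sobolev bounds of every order for the derivative of a weak solution. -/
theorem exists_sob_bound (ν : ℝ) (B₀ : ℝ≥0) (m : ℕ) : ∃ B : ℝ≥0, ∀ (h : ℝ) (θ : ℝ → ℝ),
    IsPrim θ (deriv θ) → L2Le (deriv θ) B₀ → L2Le (fun x => Real.sin (θ x) - h) B₀ →
      IsWeakSolution ν h θ → ∃ p, IsPrim θ p ∧ Sob m p B := by
  induction m with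
  | zero => exact ⟨B₀, fun h θ h1 h2 _ _ => ⟨_, h1, h2⟩⟩
  | succ m ih =>
    obtain ⟨B, hB⟩ := ih
    obtain ⟨K, hK⟩ : ∃ K : ℝ≥0, ∀ θ p : ℝ → ℝ, IsPrim θ p → Sob m p B →
        Mult m (fun x => Real.cos (θ x)) K := by
      cases m with
      | zero => exact ⟨1, fun θ p hp _ => continuous_cos_bound hp⟩
      | succ m =>
        obtain ⟨K, hK⟩ := exists_trig_bound m (2 * B)
        exact ⟨K, fun θ p hp hS => (hK θ p hp hS.mult).1⟩
    -- The bootstrap step uses one bound for both `p` and `sin θ - h`, hence the maximum.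
    refine ⟨bootstrapBound ν m (max B B₀) K, fun h θ h1 h2 h3 hw => ?_⟩
    obtain ⟨p, hp, hS⟩ := hB h θ h1 h2 h3 hw
    exact hw.exists_sob_succ hp (B := max B B₀) (hS.mono (le_max_left _ _)) (hK θ p hp hS)
      ⟨h3.1, h3.2.trans (ENNReal.coe_le_coe.2 (le_max_right _ _))⟩

/-- The function `p` may vary with `m` on a null set, but for `m ≥ 1` it is continuous and so equals
`deriv θ` everywhere. -/
theorem contDiff_infty_of_sob {θ : ℝ → ℝ} (h : ∀ m, ∃ p B, IsPrim θ p ∧ Sob m p B) :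
    ContDiff ℝ ∞ θ := by
  refine contDiff_infty.2 fun n => ?_
  obtain ⟨p, B, hp, hS⟩ := h (n + 1)
  have hd : ∀ x, HasDerivAt θ (p x) x := hp.hasDerivAt hS.continuous
  refine ContDiff.of_le (n := (n : WithTop ℕ∞) + 1) ?_ le_self_add
  rw [contDiff_succ_iff_deriv, show deriv θ = p from funext fun x => (hd x).deriv]
  exact ⟨fun x => (hd x).differentiableAt, by simp, hS.contDiff.1⟩

theorem iteratedDeriv_of_sob {θ p : ℝ → ℝ} {i : ℕ} {B : ℝ≥0} (hp : IsPrim θ p)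
    (hS : Sob (i + 1) p B) :
    (∀ x, |iteratedDeriv (i + 1) θ x| ≤ 2 * B) ∧
      Tendsto (iteratedDeriv (i + 1) θ) atTop (𝓝 0) ∧
      Tendsto (iteratedDeriv (i + 1) θ) atBot (𝓝 0) := by
  have hd : deriv θ = p := funext fun x => (hp.hasDerivAt hS.continuous x).deriv
  rw [iteratedDeriv_succ', hd]
  exact hS.contDiff.2 i le_rfl

end NeelWall

theorem theorem3 :
    (∃ C : ℕ → ℝ → ℝ → ℝ → ℝ,
      (∀ (i : ℕ) (ν h e : ℝ), 0 < C i ν h e) ∧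
      ∀ (ν h : ℝ), 0 < ν →
        ∀ θ : ℝ → ℝ, NeelWall.MemH1Loc θ → NeelWall.IsWeakSolution ν h θ →
          NeelWall.energy ν h θ < ⊤ →
            ContDiff ℝ ∞ θ ∧
            (∀ i : ℕ, 1 ≤ i → ∀ x : ℝ,
              |iteratedDeriv i θ x| ≤ C i ν h (NeelWall.energy ν h θ).toReal) ∧
            (∀ i : ℕ, 1 ≤ i → Tendsto (iteratedDeriv i θ) atTop (𝓝 0) ∧
              Tendsto (iteratedDeriv i θ) atBot (𝓝 0))) := by
  choose B hB using NeelWall.exists_sob_bound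
  -- The factor `2` is the Sobolev constant, `√(2e)` is the energy bound that starts the induction,
  -- and `+ 1` ensures positivity.
  refine ⟨fun i ν _ e => 2 * B ν (NNReal.sqrt (2 * e.toNNReal)) i + 1,
    fun i ν h e => by positivity, fun ν h hν θ hθ hw hE => ?_⟩
  obtain ⟨h1, h2⟩ := NeelWall.l2Le_of_energy hν hθ hE
  have he : (NeelWall.energy ν h θ).toReal.toNNReal = (NeelWall.energy ν h θ).toNNReal :=
    Real.toNNReal_coe
  have key := fun m => hB ν _ m h θ hθ.isPrim h1 h2 hw
  have key' : ∀ i : ℕ, 1 ≤ i →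
      (∀ x, |iteratedDeriv i θ x| ≤
        2 * B ν (NNReal.sqrt (2 * (NeelWall.energy ν h θ).toNNReal)) i) ∧
      Tendsto (iteratedDeriv i θ) atTop (𝓝 0) ∧ Tendsto (iteratedDeriv i θ) atBot (𝓝 0) := by
    intro i hi
    -- Order `i` suffices: an `H^i` bound on `θ'` controls its derivative of order `i - 1`, which is
    -- the `i`-th derivative of `θ`.
    obtain ⟨p, hp, hS⟩ := key i
    obtain ⟨j, rfl⟩ : ∃ j, i = j + 1 := ⟨i - 1, by omega⟩
    exact NeelWall.iteratedDeriv_of_sob hp hS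
  refine ⟨NeelWall.contDiff_infty_of_sob fun m => ?_, fun i hi x => ?_, fun i hi => (key' i hi).2⟩
  · obtain ⟨p, hp, hS⟩ := key m
    exact ⟨p, _, hp, hS⟩
  · simp only [he]
    exact ((key' i hi).1 x).trans (by linarith)
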